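/- All graphs are finite and simple. A closed geodesic of length $\ell\ge 1$ in a graph $G$ is a closed walk $(e_1,\dots,e_\ell)$ of oriented edges with $e_{i+1}\neq e_i^{-1}$ for $1\le i<\ell$ and $e_1\neq e_\ell^{-1}$; it is primitive if it is not the concatenation of $k\ge 2$ copies of a closed geodesic. Let $a_G(\ell)$ be the number of primitive closed geodesics of length $\ell$ up to cyclic rotation. The Ihara zeta function of $G$ is the formal power series $$Z_G(t)=\prod_{\ell>2}(1-t^\ell)^{-a_G(\ell)}.$$ The join $G\vee H$ is the disjoint union of $G$ and $H$ together with all edges between a vertex of $G$ and a vertex of $H$. For every $n\ge 1$ there is an integer $r\le\max(n,3)$ such that, for every graph $G$ of order $n$, the following hold. 1. Let $H_1,\dots,H_r$ be any graphs with pairwise distinct orders (the null graph is allowed). Then $Z_{G\vee H_1},\dots,Z_{G\vee H_r}$ determine the degree sequence of $G$, even if the order of $G$ is not known: if $G'$ is any graph of order at least $1$ with $Z_{G'\vee H_j}=Z_{G\vee H_j}$ for all $1\le j\le r$, then $G'$ and $G$ have the same degree sequence (as multisets; in particular the same order). 2. In particular, the zeta functions of the iterated cones $G\vee K_1,\dots,G\vee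 K_r$ determine the degree sequence of $G$: if $G'$ is any graph of order at least $1$ with $Z_{G'\vee K_j}=Z_{G\vee K_j}$ for all $1\le j\le r$, then $G'$ and $G$ have the same degree sequence. -/

import Mathlib

namespace SimpleGraph

/-- The join `G ∨ H`: the disjoint union of `G` and `H`, together with all edges between them. -/
def graphJoin {V W : Type*} (G : SimpleGraph V) (H : SimpleGraph W) : SimpleGraph (V ⊕ W) :=
  (G ⊕g H) ⊔ completeBipartiteGraph V W

/-- The oriented edge `f` may follow the oriented edge `e` in a walk without backtracking:
`f` starts where `e` ends, and `f` is not `e` reversed. -/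
def NonBacktrackingStep {V : Type*} (G : SimpleGraph V) (e f : G.Dart) : Prop :=
  e.snd = f.fst ∧ f ≠ e.symm

/-- A closed geodesic `γ = (e₁, …, e_ℓ)`, `ℓ ≥ 1`: a closed walk, given by its oriented edges,
without backtracking and without tails. `Cycle.Chain` requires the relation between
consecutive entries and between the last entry and the first. -/
def IsClosedGeodesic {V : Type*} (G : SimpleGraph V) (γ : List G.Dart) : Prop :=
  γ ≠ [] ∧ Cycle.Chain G.NonBacktrackingStep (γ : Cycle G.Dart)

/-- A closed geodesic is primitive if it is not the concatenation of `k ≥ 2` copies of a closed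
geodesic. -/
def IsPrimitiveGeodesic {V : Type*} (G : SimpleGraph V) (γ : List G.Dart) : Prop :=
  G.IsClosedGeodesic γ ∧
    ∀ (δ : List G.Dart) (k : ℕ), G.IsClosedGeodesic δ → 2 ≤ k → γ ≠ (List.replicate k δ).flatten

/-- `a_G(ℓ)`: the number of primitive closed geodesics of length `ℓ` up to cyclic rotation.
(`Cycle α` is the type of lists over `α` modulo rotation.) -/
noncomputable def geodesicCount {V : Type*} (G : SimpleGraph V) (l : ℕ) : ℕ :=
  Set.ncard {c : Cycle G.Dart |
    ∃ γ : List G.Dart, G.IsPrimitiveGeodesic γ ∧ γ.length = l ∧ (γ : Cycle G.Dart) = c}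

open scoped PowerSeries.WithPiTopology in
/-- The Ihara zeta function `Z_G(t) = ∏_{ℓ > 2} (1 - t^ℓ)^{-a_G(ℓ)}` as a formal power series
in `t`; the infinite product is the limit of its finite subproducts, coefficient by coefficient. -/
noncomputable def iharaZeta {V : Type*} (G : SimpleGraph V) : PowerSeries ℚ :=
  ∏' k : ℕ, ((1 - PowerSeries.X ^ (k + 3))⁻¹ : PowerSeries ℚ) ^ G.geodesicCount (k + 3)

open scoped PowerSeries.WithPiTopology in
/-- The infinite product that defines the Ihara zeta function converges. -/
theorem multipliable_iharaZeta {V : Type*} (G : SimpleGraph V) :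
    Multipliable fun k : ℕ =>
      ((1 - PowerSeries.X ^ (k + 3))⁻¹ : PowerSeries ℚ) ^ G.geodesicCount (k + 3) := by
  have h := PowerSeries.WithPiTopology.multipliable_one_add_of_tendsto_order_atTop_nhds_top ℚ
    (f := fun k : ℕ =>
      ((1 - PowerSeries.X ^ (k + 3))⁻¹ : PowerSeries ℚ) ^ G.geodesicCount (k + 3) - 1) ?_
  · simpa using h
  refine ENat.tendsto_nhds_top_iff_natCast_lt.mpr fun n => Filter.eventually_atTop.mpr ⟨n, ?_⟩
  intro k hk
  have h1 : (1 - PowerSeries.X ^ (k + 3) : PowerSeries ℚ) *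
      (1 - PowerSeries.X ^ (k + 3))⁻¹ = 1 := by
    apply PowerSeries.mul_inv_cancel
    simp
  have h2 : (PowerSeries.X ^ (k + 3) : PowerSeries ℚ) ∣
      ((1 - PowerSeries.X ^ (k + 3))⁻¹ : PowerSeries ℚ) ^ G.geodesicCount (k + 3) - 1 := by
    refine dvd_trans ⟨(1 - PowerSeries.X ^ (k + 3))⁻¹, ?_⟩ (sub_one_dvd_pow_sub_one _ _)
    linear_combination h1
  have h3 : ((k + 3 : ℕ) : ℕ∞) ≤
      (((1 - PowerSeries.X ^ (k + 3))⁻¹ : PowerSeries ℚ) ^ G.geodesicCount (k + 3) - 1).order :=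
    PowerSeries.le_order _ _ fun i hi => PowerSeries.X_pow_dvd_iff.mp h2 i (by exact_mod_cast hi)
  refine lt_of_lt_of_le ?_ h3
  exact_mod_cast (by omega : n < k + 3)

open Classical in
/-- The degree sequence of a finite graph, as a multiset. -/
noncomputable def degreeMultiset {V : Type*} [Fintype V] (G : SimpleGraph V) : Multiset ℕ :=
  Finset.univ.val.map fun v => G.degree v

end SimpleGraph

/-!
The zeta function of a finite graph `X` determines the numbers `a(ℓ)` of primitive closed geodesics,
coefficient by coefficient (`geodesicCount_eq_of_iharaZeta_eq`), and hence the numbers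
`N_k = ∑_{d ∣ k} d a(d)` of all closed geodesics of length `k` (`ncard_closedGeodesic`). Since
`N_k = tr T ^ k` for the Hashimoto matrix `T`, which records the steps without backtracking between
oriented edges, the zeta function determines the non-zero eigenvalues of `T` with their
multiplicities (`Matrix.count_roots_charpoly_eq_of_trace_pow_eq`).

Up to a permutation of the rows, `T` is `C Cᵀ - 1` with `Cᵀ C` the diagonal matrix of degrees, so
`det T = ± ∏ (1 - d_v)`, with a sign that depends on the size only (`det_hashimotoMatrix`). Let
`X = G ∨ H` with `G` of order `n` and `H` of order `p`. A vertex `v` of `G` has degree `d_v + p` in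
`X`, and a vertex `w` of `H` has degree `d_w + n`.

* If `n, p ≥ 2`, then `T` is invertible, so that its size, twice the number of edges of `X`, is
  determined, and with it `e + n p`, where `e` is the number of edges of `G`. Two such joins with
  different `p` give `n` and `e`.
* Among three distinct orders `p`, either two are at least 2, or they are `0`, `1` and some `p ≥ 2`.
  In the latter case the numbers of triangles (`N_3`) of the joins with `p = 0, 1` give `e`, and the
  third join gives `n` (`card_eq_and_sum_degree_eq`). The case `n = 1` is told apart by comparing
  sizes.
* Once `n` and `e` are known, the size of `T` is known, so the non-zero eigenvalues determine
  `det T`. For `n ≥ 2` the factor of `det T` that comes from `H` is non-zero, so `∏ (1 - (d_v + p))`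
  is determined for `n` distinct values of `p`. It is a polynomial of degree `n` in `p` with known
  leading coefficient, and its roots are the numbers `1 - d_v`
  (`degreeMultiset_eq_of_iharaZeta_graphJoin_eq`).
-/

/-! ### Closed geodesics and primitive closed geodesics -/

namespace SimpleGraph

section Words

variable {α : Type*}

/-- The shift on sequences. Closed words are encoded by periodic sequences, on which rotation
becomes the shift and the length of the primitive root becomes the minimal period. -/
def shiftSeq (s : ℕ → α) : ℕ → α := fun i => s (i + 1)

/-- The list of the first `k` terms of a sequence. -/
def seqPrefix (k : ℕ) (s : ℕ → α) : List α := (List.range k).map s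

@[simp]
theorem length_seqPrefix (k : ℕ) (s : ℕ → α) : (seqPrefix k s).length = k := by
  simp [seqPrefix]

theorem iterate_shiftSeq (k : ℕ) (s : ℕ → α) : shiftSeq^[k] s = fun i => s (i + k) := by
  induction k with
  | zero => rfl
  | succ k ih =>
    rw [Function.iterate_succ_apply', ih]
    funext i
    simp only [shiftSeq]
    congr 1
    omega

theorem isPeriodicPt_shiftSeq_iff {k : ℕ} {s : ℕ → α} :
    Function.IsPeriodicPt shiftSeq k s ↔ Function.Periodic s k := by
  rw [Function.IsPeriodicPt, Function.IsFixedPt, iterate_shiftSeq, funext_iff]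
  rfl

theorem seqPrefix_injOn {k : ℕ} (hk : 0 < k) :
    Set.InjOn (seqPrefix (α := α) k) {s | Function.Periodic s k} := by
  intro s hs t ht h
  funext i
  have hs' : Function.Periodic s k := hs
  have ht' : Function.Periodic t k := ht
  rw [← hs'.map_mod_nat, ← ht'.map_mod_nat]
  exact List.map_inj_left.mp h (i % k) (List.mem_range.mpr (Nat.mod_lt i hk))

theorem exists_periodic_seqPrefix_eq {k : ℕ} (hk : 0 < k) {γ : List α} (hγ : γ.length = k) :
    ∃ s : ℕ → α, Function.Periodic s k ∧ seqPrefix k s = γ := by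
  subst hγ
  refine ⟨fun i => γ[i % γ.length]'(Nat.mod_lt i hk), fun i => by simp, ?_⟩
  refine List.ext_getElem (by simp) fun i h1 h2 => ?_
  simp [seqPrefix, Nat.mod_eq_of_lt h2]

theorem chain_seqPrefix_iff {R : α → α → Prop} {k : ℕ} (hk : 0 < k) {s : ℕ → α}
    (hs : Function.Periodic s k) :
    Cycle.Chain R (seqPrefix k s : Cycle α) ↔ ∀ i, R (s i) (s (i + 1)) := by
  obtain ⟨k, rfl⟩ : ∃ m, k = m + 1 := ⟨k - 1, by omega⟩
  rw [seqPrefix, ← Cycle.map_coe, Cycle.chain_map, Cycle.chain_range_succ]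
  have h0 : s (k + 1) = s 0 := by simpa using hs 0
  refine ⟨fun ⟨h1, h2⟩ i => ?_, fun h => ⟨h0 ▸ h k, fun m _ => h m⟩⟩
  have h3 : ∀ j < k + 1, R (s j) (s (j + 1)) := fun j hj => by
    rcases Nat.lt_succ_iff_lt_or_eq.mp hj with hj | rfl
    · exact h2 j hj
    · rwa [h0]
  have h4 := h3 (i % (k + 1)) (Nat.mod_lt _ hk)
  rwa [hs.map_mod_nat, ← hs.map_mod_nat (i % (k + 1) + 1), Nat.mod_add_mod,
    hs.map_mod_nat] at h4

theorem rotate_seqPrefix {k : ℕ} (s : ℕ → α) (hs : Function.Periodic s k) (j : ℕ) :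
    (seqPrefix k s).rotate j = seqPrefix k (shiftSeq^[j] s) := by
  refine List.ext_getElem (by simp) fun i h1 h2 => ?_
  simp [seqPrefix, List.getElem_rotate, iterate_shiftSeq, hs.map_mod_nat]

theorem seqPrefix_mul {d : ℕ} {s : ℕ → α} (hs : Function.Periodic s d) (m : ℕ) :
    seqPrefix (m * d) s = (List.replicate m (seqPrefix d s)).flatten := by
  induction m with
  | zero => simp [seqPrefix]
  | succ m ih =>
    rw [List.replicate_succ, List.flatten_cons, ← ih, Nat.succ_mul, Nat.add_comm]
    simp only [seqPrefix, List.range_add, List.map_append, List.map_map]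
    congr 2
    funext i
    simpa [Nat.add_comm] using hs i

theorem finite_periodic_seq [Finite α] {k : ℕ} (hk : 0 < k) :
    {s : ℕ → α | Function.Periodic s k}.Finite :=
  Set.Finite.of_finite_image ((List.finite_length_eq α k).subset (by rintro _ ⟨s, -, rfl⟩; simp))
    (seqPrefix_injOn hk)

end Words

variable {V : Type*} (G : SimpleGraph V)

/-- The one-sided infinite geodesics of `G`, as sequences of oriented edges. -/
def geodesicSeqs : Set (ℕ → G.Dart) := {s | ∀ i, G.NonBacktrackingStep (s i) (s (i + 1))}

variable {G}

theorem isClosedGeodesic_seqPrefix_iff {k : ℕ} (hk : 0 < k) {s : ℕ → G.Dart}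
    (hs : Function.Periodic s k) :
    G.IsClosedGeodesic (seqPrefix k s) ↔ s ∈ G.geodesicSeqs := by
  rw [IsClosedGeodesic, chain_seqPrefix_iff hk hs]
  refine and_iff_right fun h => ?_
  have := length_seqPrefix k s
  rw [h] at this
  simp at this
  omega

theorem bijOn_seqPrefix_closedGeodesic {k : ℕ} (hk : 0 < k) :
    Set.BijOn (seqPrefix k) {s | s ∈ G.geodesicSeqs ∧ Function.Periodic s k}
      {γ | G.IsClosedGeodesic γ ∧ γ.length = k} := by
  refine ⟨fun s hs => ⟨(isClosedGeodesic_seqPrefix_iff hk hs.2).mpr hs.1, by simp⟩,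
    (seqPrefix_injOn hk).mono fun s hs => hs.2, fun γ hγ => ?_⟩
  obtain ⟨s, hs, rfl⟩ := exists_periodic_seqPrefix_eq hk hγ.2
  exact ⟨s, ⟨(isClosedGeodesic_seqPrefix_iff hk hs).mp hγ.1, hs⟩, rfl⟩

theorem periodic_minimalPeriod {α : Type*} (s : ℕ → α) :
    Function.Periodic s (Function.minimalPeriod shiftSeq s) :=
  isPeriodicPt_shiftSeq_iff.mp (Function.isPeriodicPt_minimalPeriod _ _)

/-- The primitive closed geodesics of length `k` correspond to the geodesic sequences of minimal
period `k`: an expression as an `m`-th power with `m ≥ 2` is a smaller period. -/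
theorem bijOn_seqPrefix_primitiveGeodesic {k : ℕ} (hk : 0 < k) :
    Set.BijOn (seqPrefix k) {s | s ∈ G.geodesicSeqs ∧ Function.minimalPeriod shiftSeq s = k}
      {γ | G.IsPrimitiveGeodesic γ ∧ γ.length = k} := by
  have hper : ∀ s : ℕ → G.Dart, Function.minimalPeriod shiftSeq s = k → Function.Periodic s k :=
    fun s hs => hs ▸ periodic_minimalPeriod s
  refine ⟨fun s hs => ⟨⟨(isClosedGeodesic_seqPrefix_iff hk (hper s hs.2)).mpr hs.1, ?_⟩, by simp⟩,
    (seqPrefix_injOn hk).mono fun s hs => hper s hs.2, fun γ hγ => ?_⟩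
  · intro δ m hδ hm h
    have hd : 0 < δ.length := List.length_pos_iff.mpr hδ.1
    obtain ⟨t, ht, htδ⟩ := exists_periodic_seqPrefix_eq hd rfl
    rw [← htδ, ← seqPrefix_mul ht] at h
    have hlen := congrArg List.length h
    simp only [length_seqPrefix] at hlen
    rw [← hlen] at h
    have htk : Function.Periodic t k := by
      rw [hlen]; simpa using ht.nat_mul m
    obtain rfl : s = t := seqPrefix_injOn hk (hper s hs.2) htk h
    have := Function.IsPeriodicPt.minimalPeriod_le hd (isPeriodicPt_shiftSeq_iff.mpr ht)
    rw [hs.2] at this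
    nlinarith
  · obtain ⟨s, hs, rfl⟩ := exists_periodic_seqPrefix_eq hk hγ.2
    have hsG := (isClosedGeodesic_seqPrefix_iff hk hs).mp hγ.1.1
    refine ⟨s, ⟨hsG, ?_⟩, rfl⟩
    obtain ⟨m, hm⟩ := (isPeriodicPt_shiftSeq_iff.mpr hs).minimalPeriod_dvd
    set d := Function.minimalPeriod shiftSeq s with hd
    have hd0 : 0 < d := Nat.pos_of_ne_zero fun h => by simp [h] at hm; omega
    rcases Nat.lt_or_ge m 2 with hm2 | hm2
    · interval_cases m
      · omega
      · omega
    · exfalso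
      refine hγ.1.2 (seqPrefix d s) m ((isClosedGeodesic_seqPrefix_iff hd0
        (periodic_minimalPeriod s)).mpr hsG) hm2 ?_
      rw [← seqPrefix_mul (periodic_minimalPeriod s), ← hd, Nat.mul_comm, ← hm]

variable [Finite V]

instance finite_dart : Finite G.Dart :=
  Finite.of_injective _ (Dart.toProd_injective (G := G))

/-- The periodic geodesics with period `k`, sorted by their minimal periods, which divide `k`. -/
theorem ncard_periodic_geodesicSeqs {k : ℕ} (hk : 0 < k) :
    {s | s ∈ G.geodesicSeqs ∧ Function.Periodic s k}.ncard =
      ∑ d ∈ k.divisors,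
        {s | s ∈ G.geodesicSeqs ∧ Function.minimalPeriod shiftSeq s = d}.ncard := by
  classical
  have hfin : ∀ d, 0 < d → {s | s ∈ G.geodesicSeqs ∧ Function.Periodic s d}.Finite := fun d hd =>
    (finite_periodic_seq hd).subset fun s hs => hs.2
  rw [Set.ncard_eq_toFinset_card _ (hfin k hk),
    Finset.card_eq_sum_card_fiberwise (f := Function.minimalPeriod shiftSeq) (t := k.divisors)]
  · refine Finset.sum_congr rfl fun d hd => ?_
    rw [← Set.ncard_coe_finset]
    congr 1
    ext s
    simp only [Finset.coe_filter, Set.Finite.mem_toFinset, Set.mem_ofPred_eq]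
    refine ⟨fun h => ⟨h.1.1, h.2⟩, fun h => ⟨⟨h.1, ?_⟩, h.2⟩⟩
    obtain ⟨m, rfl⟩ := Nat.dvd_of_mem_divisors hd
    rw [← h.2, mul_comm]
    simpa using (periodic_minimalPeriod s).nat_mul m
  · intro s hs
    simp only [Set.Finite.coe_toFinset, Set.mem_ofPred_eq] at hs
    exact Nat.mem_divisors.mpr ⟨(isPeriodicPt_shiftSeq_iff.mpr hs.2).minimalPeriod_dvd, hk.ne'⟩

/-- Each rotation class of primitive closed geodesics of length `k` has exactly `k` members. -/
theorem ncard_primitiveGeodesic {k : ℕ} (hk : 0 < k) :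
    {γ | G.IsPrimitiveGeodesic γ ∧ γ.length = k}.ncard = k * G.geodesicCount k := by
  classical
  have hfin : {γ | G.IsPrimitiveGeodesic γ ∧ γ.length = k}.Finite :=
    (List.finite_length_eq G.Dart k).subset fun γ hγ => hγ.2
  have himg : {c : Cycle G.Dart |
      ∃ γ : List G.Dart, G.IsPrimitiveGeodesic γ ∧ γ.length = k ∧ (γ : Cycle G.Dart) = c} =
      (fun γ : List G.Dart => (γ : Cycle G.Dart)) ''
        {γ | G.IsPrimitiveGeodesic γ ∧ γ.length = k} := by
    ext c
    simp [and_assoc]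
  rw [geodesicCount, himg, Set.ncard_eq_toFinset_card _ hfin,
    Set.ncard_eq_toFinset_card _ (hfin.image _), Set.Finite.toFinset_image, mul_comm]
  rw [Finset.card_eq_sum_card_image (fun γ : List G.Dart => (γ : Cycle G.Dart)),
    Finset.sum_const_nat]
  intro c hc
  obtain ⟨γ, hγ, rfl⟩ := Finset.mem_image.mp hc
  obtain ⟨s, ⟨hsG, hsk⟩, rfl⟩ := (bijOn_seqPrefix_primitiveGeodesic hk).surjOn
    ((Set.Finite.mem_toFinset hfin).mp hγ)
  have hper : Function.Periodic s k := hsk ▸ periodic_minimalPeriod s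
  have hperj : ∀ j, Function.minimalPeriod shiftSeq (shiftSeq^[j] s) = k := fun j => by
    rw [Function.minimalPeriod_apply_iterate ⟨k, hk, isPeriodicPt_shiftSeq_iff.mpr hper⟩, hsk]
  have hfib : hfin.toFinset.filter
      (fun δ : List G.Dart => (δ : Cycle G.Dart) = (seqPrefix k s : List G.Dart)) =
      (Finset.range k).image fun j => (seqPrefix k s).rotate j := by
    ext δ
    simp only [Finset.mem_filter, Set.Finite.mem_toFinset, Set.mem_ofPred_eq, Finset.mem_image,
      Finset.mem_range, Cycle.coe_eq_coe]
    constructor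
    · rintro ⟨-, h⟩
      obtain ⟨j, hj, hj'⟩ := List.isRotated_iff_mod.mp h.symm
      rcases Nat.lt_or_ge j k with hjk | hjk
      · exact ⟨j, hjk, hj'⟩
      · obtain rfl : j = k := le_antisymm (by simpa using hj) hjk
        refine ⟨0, hk, ?_⟩
        rw [← hj']
        simpa using (List.rotate_length (seqPrefix j s)).symm
    · rintro ⟨j, -, rfl⟩
      refine ⟨?_, List.IsRotated.forall _ _⟩
      rw [rotate_seqPrefix s hper]
      refine (bijOn_seqPrefix_primitiveGeodesic hk).mapsTo ⟨fun i => ?_, hperj j⟩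
      have := hsG (i + j)
      rw [iterate_shiftSeq]
      simpa [Nat.add_right_comm] using this
  rw [hfib, Finset.card_image_of_injOn, Finset.card_range]
  intro i hi j hj hij
  simp only [rotate_seqPrefix s hper] at hij
  have h := seqPrefix_injOn hk (by exact hperj i ▸ periodic_minimalPeriod _)
    (by exact hperj j ▸ periodic_minimalPeriod _) hij
  exact Function.iterate_injOn_Iio_minimalPeriod (by simpa [hsk] using hi)
    (by simpa [hsk] using hj) h

/-- Every closed geodesic is a power of a unique primitive one, and a primitive one of length `d`
has `d` distinct rotations. -/
theorem ncard_closedGeodesic {k : ℕ} (hk : 0 < k) :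
    {γ | G.IsClosedGeodesic γ ∧ γ.length = k}.ncard =
      ∑ d ∈ k.divisors, d * G.geodesicCount d := by
  rw [← (bijOn_seqPrefix_closedGeodesic hk).image_eq,
    (bijOn_seqPrefix_closedGeodesic hk).injOn.ncard_image, ncard_periodic_geodesicSeqs hk]
  refine Finset.sum_congr rfl fun d hd => ?_
  have hd0 := Nat.pos_of_mem_divisors hd
  rw [← ncard_primitiveGeodesic hd0, ← (bijOn_seqPrefix_primitiveGeodesic hd0).image_eq,
    (bijOn_seqPrefix_primitiveGeodesic hd0).injOn.ncard_image]

end SimpleGraph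

/-! ### Recovering geodesic counts from the Euler product -/

namespace SimpleGraph

section EulerProduct

open PowerSeries

/-- Modulo `X ^ (m + 1)`, the Euler factor `(1 - X ^ m)⁻¹ ^ a` is `1 + a X ^ m`. -/
theorem X_pow_dvd_inv_one_sub_X_pow_pow_sub {m : ℕ} (hm : 0 < m) (a : ℕ) :
    (X ^ (m + 1) : ℚ⟦X⟧) ∣ ((1 - X ^ m)⁻¹) ^ a - (1 + C (a : ℚ) * X ^ m) := by
  have h1 : (1 - X ^ m : ℚ⟦X⟧) * (1 - X ^ m)⁻¹ = 1 := by
    apply PowerSeries.mul_inv_cancel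
    simp [hm.ne']
  set f := (1 - X ^ m : ℚ⟦X⟧)⁻¹ with hf
  have h2 : (X ^ (m + 1) : ℚ⟦X⟧) ∣ X ^ m * X ^ m := by
    rw [← pow_add]; exact pow_dvd_pow _ (by omega)
  have h3 : (X ^ (m + 1) : ℚ⟦X⟧) ∣ f - (1 + X ^ m) := by
    refine h2.trans ⟨f, ?_⟩
    linear_combination (1 + X ^ m) * h1
  induction a with
  | zero => simp
  | succ a ih =>
    have : f ^ (a + 1) - (1 + C ((a + 1 : ℕ) : ℚ) * X ^ m) =
        (f ^ a - (1 + C (a : ℚ) * X ^ m)) * f + (1 + C (a : ℚ) * X ^ m) * (f - (1 + X ^ m))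
          + C (a : ℚ) * (X ^ m * X ^ m) := by
      push_cast [map_add, map_one]
      ring
    rw [this]
    exact dvd_add (dvd_add (ih.mul_right _) (h3.mul_left _)) (h2.mul_left _)

open scoped PowerSeries.WithPiTopology in
/-- The factors with exponent at least `k + 3` do not affect the coefficients of the Ihara zeta
function up to `X ^ (k + 2)`. -/
theorem X_pow_dvd_iharaZeta_sub {V : Type*} (G : SimpleGraph V) (k : ℕ) :
    (X ^ (k + 3) : ℚ⟦X⟧) ∣ G.iharaZeta -
      ∏ i ∈ Finset.range k, ((1 - X ^ (i + 3))⁻¹ : ℚ⟦X⟧) ^ G.geodesicCount (i + 3) := by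
  set f : ℕ → ℚ⟦X⟧ := fun i => ((1 - X ^ (i + 3))⁻¹ : ℚ⟦X⟧) ^ G.geodesicCount (i + 3) with hf
  have hfac : ∀ i, k ≤ i → (X ^ (k + 3) : ℚ⟦X⟧) ∣ f i - 1 := fun i hi => by
    refine (pow_dvd_pow X (by omega : k + 3 ≤ i + 3)).trans ?_
    have h := (pow_dvd_pow (X : ℚ⟦X⟧) (by omega : i + 3 ≤ i + 3 + 1)).trans
      (X_pow_dvd_inv_one_sub_X_pow_pow_sub (by omega : 0 < i + 3) (G.geodesicCount (i + 3)))
    have h' := dvd_add h (Dvd.intro_left (C (G.geodesicCount (i + 3) : ℚ)) rfl)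
    convert h' using 1
    simp only [hf]
    ring
  have hprod : ∀ s : Finset ℕ, Finset.range k ⊆ s →
      (X ^ (k + 3) : ℚ⟦X⟧) ∣ ∏ i ∈ s, f i - ∏ i ∈ Finset.range k, f i := fun s hs => by
    rw [← Finset.prod_sdiff hs]
    have h1 : (X ^ (k + 3) : ℚ⟦X⟧) ∣ ∏ i ∈ s \ Finset.range k, f i - 1 := by
      have : ∀ t : Finset ℕ, (∀ i ∈ t, k ≤ i) → (X ^ (k + 3) : ℚ⟦X⟧) ∣ ∏ i ∈ t, f i - 1 := by
        intro t
        induction t using Finset.induction_on with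
        | empty => simp
        | insert a t ha ih =>
          intro ht
          rw [Finset.prod_insert ha]
          have e : f a * ∏ i ∈ t, f i - 1 = (f a - 1) * ∏ i ∈ t, f i + (∏ i ∈ t, f i - 1) := by ring
          rw [e]
          exact dvd_add ((hfac a (ht a (Finset.mem_insert_self _ _))).mul_right _)
            (ih fun i hi => ht i (Finset.mem_insert_of_mem hi))
      exact this _ fun i hi => by simpa using (Finset.mem_sdiff.mp hi).2
    have e : (∏ i ∈ s \ Finset.range k, f i) * ∏ i ∈ Finset.range k, f i -
        ∏ i ∈ Finset.range k, f i =
        (∏ i ∈ s \ Finset.range k, f i - 1) * ∏ i ∈ Finset.range k, f i := by ring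
    rw [e]
    exact h1.mul_right _
  rw [X_pow_dvd_iff]
  intro j hj
  rw [map_sub, sub_eq_zero]
  have hlim := ((PowerSeries.WithPiTopology.continuous_coeff ℚ j).tendsto _).comp
    G.multipliable_iharaZeta.hasProd
  refine tendsto_nhds_unique hlim (tendsto_const_nhds.congr' ?_)
  filter_upwards [Filter.eventually_ge_atTop (Finset.range k)] with s hs
  have := X_pow_dvd_iff.mp (hprod s hs) j hj
  rw [map_sub, sub_eq_zero] at this
  exact this.symm

/-- By induction on the length: once the shorter factors are known to agree, the coefficient of
`X ^ (k + 3)` in the Euler product gives the exponent of the factor for length `k + 3`. -/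
theorem geodesicCount_eq_of_iharaZeta_eq {V V' : Type*} {G : SimpleGraph V} {G' : SimpleGraph V'}
    (h : G.iharaZeta = G'.iharaZeta) (k : ℕ) :
    G.geodesicCount (k + 3) = G'.geodesicCount (k + 3) := by
  induction k using Nat.strong_induction_on with
  | _ k ih =>
    set P : ℚ⟦X⟧ :=
      ∏ i ∈ Finset.range k, ((1 - X ^ (i + 3))⁻¹ : ℚ⟦X⟧) ^ G.geodesicCount (i + 3) with hP
    have hP' : P = ∏ i ∈ Finset.range k, ((1 - X ^ (i + 3))⁻¹ : ℚ⟦X⟧) ^ G'.geodesicCount (i + 3) :=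
      Finset.prod_congr rfl fun i hi => by rw [ih i (Finset.mem_range.mp hi)]
    have h1 := X_pow_dvd_iharaZeta_sub G (k + 1)
    have h2 := X_pow_dvd_iharaZeta_sub G' (k + 1)
    rw [Finset.prod_range_succ, ← hP] at h1
    rw [Finset.prod_range_succ, ← hP', ← h] at h2
    have h3 := X_pow_dvd_inv_one_sub_X_pow_pow_sub (by omega : 0 < k + 3) (G.geodesicCount (k + 3))
    have h4 := X_pow_dvd_inv_one_sub_X_pow_pow_sub (by omega : 0 < k + 3) (G'.geodesicCount (k + 3))
    have h5 : (X ^ (k + 3 + 1) : ℚ⟦X⟧) ∣ X ^ (k + 3) *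
        (P * C ((G.geodesicCount (k + 3) : ℚ) - G'.geodesicCount (k + 3))) := by
      have h6 := dvd_add (dvd_sub h2 h1) ((dvd_sub h4 h3).mul_left P)
      convert h6 using 1
      rw [map_sub]
      ring
    rw [pow_succ, mul_dvd_mul_iff_left (pow_ne_zero _ X_ne_zero), X_dvd_iff, map_mul] at h5
    have hP0 : constantCoeff P = 1 := by
      rw [hP, map_prod]
      refine Finset.prod_eq_one fun i _ => ?_
      simp
    rw [hP0, one_mul, constantCoeff_C, sub_eq_zero] at h5
    exact_mod_cast h5

end EulerProduct

end SimpleGraph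

/-! ### Traces of powers and eigenvalues -/

section PowerSums

open Polynomial

namespace Matrix

variable {n K : Type*} [Fintype n] [DecidableEq n] [Field K] [IsAlgClosed K]

theorem card_roots_charpoly (A : Matrix n n K) : A.charpoly.roots.card = Fintype.card n := by
  rw [← (IsAlgClosed.splits A.charpoly).natDegree_eq_card_roots, charpoly_natDegree_eq_dim]

/-- Both sides are multiplicative in `p`, so that it suffices to take `p` constant or `X - r`; in
the latter case both are `± A.charpoly.eval r`. -/
theorem det_aeval_eq_prod_roots_charpoly (A : Matrix n n K) (p : K[X]) :
    (aeval A p).det = (A.charpoly.roots.map fun x => p.eval x).prod := by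
  have hcard : A.charpoly.roots.card = Fintype.card n := A.card_roots_charpoly
  have hlin : ∀ r : K, (aeval A (X - C r)).det = (A.charpoly.roots.map fun x => x - r).prod := by
    intro r
    have h := A.eval_charpoly r
    rw [(IsAlgClosed.splits A.charpoly).eq_prod_roots_of_monic A.charpoly_monic,
      eval_multiset_prod, Multiset.map_map] at h
    simp only [Function.comp_def, eval_sub, eval_X, eval_C] at h
    have e : aeval A (X - C r) = -(scalar n r - A) := by
      simp [algebraMap_eq_diagonal, scalar_apply, Pi.algebraMap_def]
    rw [e, det_neg, ← h, ← hcard]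
    have : ∀ s : Multiset K, (-1) ^ s.card * (s.map fun x => r - x).prod =
        (s.map fun x => x - r).prod := by
      intro s
      induction s using Multiset.induction_on with
      | empty => simp
      | cons a s ih =>
        rw [Multiset.card_cons, Multiset.map_cons, Multiset.map_cons, Multiset.prod_cons,
          Multiset.prod_cons, ← ih]
        ring
    exact this _
  have hsplit : ∀ s : Multiset K, (aeval A (s.map fun r => X - C r).prod).det =
      (A.charpoly.roots.map fun x => ((s.map fun r => X - C r).prod : K[X]).eval x).prod := by
    intro s
    induction s using Multiset.induction_on with
    | empty => simp
    | cons a s ih =>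
      simp only [Multiset.map_cons, Multiset.prod_cons, map_mul, det_mul, eval_mul,
        Multiset.prod_map_mul, ih, hlin]
      simp
  conv_lhs => rw [(IsAlgClosed.splits p).eq_prod_roots]
  conv_rhs => rw [(IsAlgClosed.splits p).eq_prod_roots]
  simp only [map_mul, det_mul, eval_mul, Multiset.prod_map_mul, hsplit]
  congr 1
  simp [algebraMap_eq_diagonal, hcard]

theorem roots_charpoly_aeval (A : Matrix n n K) (p : K[X]) :
    (aeval A p).charpoly.roots = A.charpoly.roots.map fun x => p.eval x := by
  have h : (aeval A p).charpoly = ((A.charpoly.roots.map fun x => p.eval x).map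
      fun r => X - C r).prod := by
    refine Polynomial.funext fun x => ?_
    rw [eval_charpoly, eval_multiset_prod]
    have e : scalar n x - aeval A p = aeval A (C x - p) := by
      simp [algebraMap_eq_diagonal, scalar_apply, Pi.algebraMap_def]
    rw [e, det_aeval_eq_prod_roots_charpoly]
    simp
  rw [h, roots_multiset_prod_X_sub_C]

theorem trace_aeval_eq_sum_roots_charpoly (A : Matrix n n K) (p : K[X]) :
    (aeval A p).trace = (A.charpoly.roots.map fun x => p.eval x).sum := by
  rw [trace_eq_sum_roots_charpoly, roots_charpoly_aeval]

variable {m : Type*} [Fintype m] [DecidableEq m] [CharZero K]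

/-- The traces of the positive powers of a matrix determine its non-zero eigenvalues, with
multiplicities: a polynomial that vanishes at `0` and at all eigenvalues but one, where it is `1`,
turns the traces into the multiplicity of that eigenvalue. -/
theorem count_roots_charpoly_eq_of_trace_pow_eq {A : Matrix n n K} {B : Matrix m m K}
    (h : ∀ k, 0 < k → (A ^ k).trace = (B ^ k).trace) [DecidableEq K] {a : K} (ha : a ≠ 0) :
    A.charpoly.roots.count a = B.charpoly.roots.count a := by
  set s : Finset K := insert 0 (A.charpoly.roots.toFinset ∪ B.charpoly.roots.toFinset) with hs
  set p : K[X] := Lagrange.interpolate s id (fun b => if b = a then 1 else 0) with hp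
  have heval : ∀ b ∈ s, p.eval b = if b = a then 1 else 0 := fun b hb =>
    Lagrange.eval_interpolate_at_node _ Function.injective_id.injOn hb
  have hp0 : p.coeff 0 = 0 := by
    rw [coeff_zero_eq_eval_zero, heval 0 (by simp [hs]), if_neg (Ne.symm ha)]
  have htr : (aeval A p).trace = (aeval B p).trace := by
    rw [aeval_eq_sum_range, aeval_eq_sum_range, trace_sum, trace_sum]
    refine Finset.sum_congr rfl fun k _ => ?_
    rcases Nat.eq_zero_or_pos k with rfl | hk
    · simp [hp0]
    · rw [trace_smul, trace_smul, h k hk]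
  have hcount : ∀ t : Multiset K, (∀ b ∈ t, b ∈ s) →
      (t.map fun x => p.eval x).sum = (t.count a : K) := by
    intro t ht
    rw [Multiset.map_congr rfl fun b hb => heval b (ht b hb)]
    clear ht
    induction t using Multiset.induction_on with
    | empty => simp
    | cons b t ih =>
      rw [Multiset.map_cons, Multiset.sum_cons, ih, Multiset.count_cons]
      push_cast
      simp only [eq_comm (a := a)]
      ring
  rw [trace_aeval_eq_sum_roots_charpoly, trace_aeval_eq_sum_roots_charpoly,
    hcount _ fun b hb => by rw [hs]; simp only [Finset.mem_insert, Finset.mem_union,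
      Multiset.mem_toFinset]; exact Or.inr (Or.inl hb),
    hcount _ fun b hb => by rw [hs]; simp only [Finset.mem_insert, Finset.mem_union,
      Multiset.mem_toFinset]; exact Or.inr (Or.inr hb)] at htr
  exact_mod_cast htr

/-- If `A` is invertible, then all its eigenvalues are non-zero, so they are among those of `B`. -/
theorem roots_charpoly_le_of_trace_pow_eq {A : Matrix n n K} {B : Matrix m m K}
    (h : ∀ k, 0 < k → (A ^ k).trace = (B ^ k).trace) (hA : A.det ≠ 0) :
    A.charpoly.roots ≤ B.charpoly.roots := by
  classical
  rw [Multiset.le_iff_count]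
  intro a
  rcases eq_or_ne a 0 with rfl | ha
  · rw [Multiset.count_eq_zero_of_notMem]
    · exact Nat.zero_le _
    · intro h0
      rw [det_eq_prod_roots_charpoly] at hA
      exact hA (Multiset.prod_eq_zero h0)
  · exact (count_roots_charpoly_eq_of_trace_pow_eq h ha).le

theorem card_le_of_trace_pow_eq {A : Matrix n n K} {B : Matrix m m K}
    (h : ∀ k, 0 < k → (A ^ k).trace = (B ^ k).trace) (hA : A.det ≠ 0) :
    Fintype.card n ≤ Fintype.card m := by
  simpa only [card_roots_charpoly] using
    Multiset.card_le_card (roots_charpoly_le_of_trace_pow_eq h hA)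

theorem det_eq_of_trace_pow_eq {A : Matrix n n K} {B : Matrix m m K}
    (h : ∀ k, 0 < k → (A ^ k).trace = (B ^ k).trace) (hcard : Fintype.card n = Fintype.card m) :
    A.det = B.det := by
  rw [det_eq_prod_roots_charpoly, det_eq_prod_roots_charpoly]
  by_cases hA : A.det = 0
  · by_cases hB : B.det = 0
    · rw [← det_eq_prod_roots_charpoly, ← det_eq_prod_roots_charpoly, hA, hB]
    · rw [Multiset.eq_of_le_of_card_le (roots_charpoly_le_of_trace_pow_eq
        (fun k hk => (h k hk).symm) hB) (by simp only [card_roots_charpoly, hcard, le_refl])]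
  · rw [Multiset.eq_of_le_of_card_le (roots_charpoly_le_of_trace_pow_eq h hA)
      (by simp only [card_roots_charpoly, hcard, le_refl])]

end Matrix

end PowerSums

/-! ### The Hashimoto matrix -/

/-- The entries of the powers of the 0-1 matrix of a relation count chains; here `l` lists the `k`
intermediate points of a chain with `k + 1` steps. -/
theorem Matrix.pow_succ_apply_eq_ncard_isChain {α : Type*} [Fintype α] [DecidableEq α]
    (R : α → α → Prop) [DecidableRel R] (k : ℕ) (a b : α) :
    ((Matrix.of fun x y => if R x y then (1 : ℂ) else 0) ^ (k + 1)) a b =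
      ({l : List α | l.length = k ∧ List.IsChain R (a :: (l ++ [b]))}.ncard : ℂ) := by
  induction k generalizing a with
  | zero =>
    have h : {l : List α | l.length = 0 ∧ List.IsChain R (a :: (l ++ [b]))} =
        if R a b then {[]} else ∅ := by
      ext l
      rcases l with _ | ⟨c, l⟩ <;> split_ifs <;> simp [*]
    rw [h]
    split_ifs with hab <;> simp [hab]
  | succ k ih =>
    have h : {l : List α | l.length = k + 1 ∧ List.IsChain R (a :: (l ++ [b]))} =
        ⋃ c : α, (List.cons c) ''
          {l : List α | R a c ∧ l.length = k ∧ List.IsChain R (c :: (l ++ [b]))} := by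
      ext l
      rcases l with _ | ⟨c, l⟩
      · simp
      · simp [and_left_comm]
    have hfin : ∀ c, (List.cons c ''
        {l : List α | R a c ∧ l.length = k ∧ List.IsChain R (c :: (l ++ [b]))}).Finite := fun c =>
      ((List.finite_length_eq α k).subset fun l hl => hl.2.1).image _
    rw [h, Set.ncard_iUnion_of_finite hfin, pow_succ', mul_apply, finsum_eq_sum_of_fintype,
      Nat.cast_sum]
    · refine Finset.sum_congr rfl fun c _ => ?_
      rw [ih, Set.ncard_image_of_injective _ (List.cons_injective)]
      by_cases hac : R a c <;> simp [hac]
    · intro c d hcd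
      rw [Function.onFun, Set.disjoint_left]
      rintro _ ⟨l, -, rfl⟩ ⟨l', -, h⟩
      exact hcd (List.cons_eq_cons.mp h).1.symm

namespace SimpleGraph

variable {V : Type*} (G : SimpleGraph V)

open Classical in
/-- The Hashimoto matrix of `G`, indexed by the oriented edges: the transition matrix of walks
without backtracking. -/
noncomputable def hashimotoMatrix : Matrix G.Dart G.Dart ℂ :=
  Matrix.of fun e f => if G.NonBacktrackingStep e f then 1 else 0

theorem trace_hashimotoMatrix_pow [Fintype G.Dart] [DecidableEq G.Dart] {k : ℕ} (hk : 0 < k) :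
    (G.hashimotoMatrix ^ k).trace = ({γ | G.IsClosedGeodesic γ ∧ γ.length = k}.ncard : ℂ) := by
  classical
  obtain ⟨k, rfl⟩ : ∃ m, k = m + 1 := ⟨k - 1, by omega⟩
  have h : {γ | G.IsClosedGeodesic γ ∧ γ.length = k + 1} = ⋃ e : G.Dart, (List.cons e) ''
      {l | l.length = k ∧ List.IsChain G.NonBacktrackingStep (e :: (l ++ [e]))} := by
    ext γ
    rcases γ with _ | ⟨e, γ⟩
    · simp
    · simp [IsClosedGeodesic, and_comm]
  rw [h, Set.ncard_iUnion_of_finite, finsum_eq_sum_of_fintype, Nat.cast_sum]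
  · refine Finset.sum_congr rfl fun e _ => ?_
    rw [Set.ncard_image_of_injective _ List.cons_injective, Matrix.diag_apply,
      ← Matrix.pow_succ_apply_eq_ncard_isChain]
    rfl
  · exact fun e => ((List.finite_length_eq _ k).subset fun l hl => hl.1).image _
  · intro c d hcd
    rw [Function.onFun, Set.disjoint_left]
    rintro _ ⟨l, -, rfl⟩ ⟨l', -, h⟩
    exact hcd (List.cons_eq_cons.mp h).1.symm

variable {G}

theorem not_nonBacktrackingStep_cycle_two (e f : G.Dart) :
    ¬(G.NonBacktrackingStep e f ∧ G.NonBacktrackingStep f e) := by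
  rintro ⟨⟨h1, h2⟩, h3, -⟩
  exact h2 (Dart.ext _ _ (Prod.ext h1.symm h3))

theorem geodesicCount_eq_zero {k : ℕ} (hk : k < 3) : G.geodesicCount k = 0 := by
  rw [geodesicCount]
  refine (congrArg Set.ncard (Set.eq_empty_of_forall_notMem ?_)).trans (Set.ncard_empty _)
  rintro _ ⟨γ, ⟨⟨h0, hγ⟩, -⟩, hlen, -⟩
  match γ with
  | [] => exact h0 rfl
  | [e] =>
    rw [Cycle.chain_singleton] at hγ
    exact e.adj.ne hγ.1.symm
  | [e, f] =>
    simp only [Cycle.chain_coe_cons, List.cons_append, List.nil_append,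
      List.isChain_cons_cons] at hγ
    exact not_nonBacktrackingStep_cycle_two e f ⟨hγ.1, hγ.2.1⟩
  | _ :: _ :: _ :: _ => simp at hlen; omega

theorem ncard_closedGeodesic_eq_of_iharaZeta_eq {V' : Type*} [Finite V] [Finite V']
    {G' : SimpleGraph V'} (h : G.iharaZeta = G'.iharaZeta) {k : ℕ} (hk : 0 < k) :
    {γ | G.IsClosedGeodesic γ ∧ γ.length = k}.ncard =
      {γ | G'.IsClosedGeodesic γ ∧ γ.length = k}.ncard := by
  rw [ncard_closedGeodesic hk, ncard_closedGeodesic hk]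
  refine Finset.sum_congr rfl fun d _ => ?_
  rcases Nat.lt_or_ge d 3 with hd | hd
  · rw [geodesicCount_eq_zero hd, geodesicCount_eq_zero hd]
  · obtain ⟨i, rfl⟩ := Nat.exists_eq_add_of_le' hd
    rw [geodesicCount_eq_of_iharaZeta_eq h i]

theorem trace_hashimotoMatrix_pow_eq_of_iharaZeta_eq {V' : Type*} [Finite V] [Finite V']
    {G' : SimpleGraph V'} (h : G.iharaZeta = G'.iharaZeta)
    [Fintype G.Dart] [DecidableEq G.Dart] [Fintype G'.Dart] [DecidableEq G'.Dart]
    (k : ℕ) (hk : 0 < k) :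
    (G.hashimotoMatrix ^ k).trace = (G'.hashimotoMatrix ^ k).trace := by
  rw [trace_hashimotoMatrix_pow G hk, trace_hashimotoMatrix_pow G' hk,
    ncard_closedGeodesic_eq_of_iharaZeta_eq h hk]

variable [Fintype V] [DecidableEq V] [DecidableRel G.Adj]

theorem sign_dart_symm :
    Equiv.Perm.sign (Dart.symm_involutive.toPerm (Dart.symm : G.Dart → G.Dart)) =
      (-1) ^ (Fintype.card G.Dart / 2) := by
  have hsq : (Dart.symm_involutive.toPerm (Dart.symm : G.Dart → G.Dart)) ^ 2 = 1 := by
    ext d : 1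
    simp [pow_two]
  have hfix : IsEmpty (Function.fixedPoints
      (Dart.symm_involutive.toPerm (Dart.symm : G.Dart → G.Dart))) :=
    ⟨fun d => d.1.symm_ne d.2⟩
  rw [Equiv.Perm.sign_of_pow_two_eq_one hsq, Fintype.card_eq_zero (α := Function.fixedPoints _),
    Nat.sub_zero]

/-- Up to reversing the row index, the Hashimoto matrix is `C Cᵀ - 1` with `C` the incidence matrix
of oriented edges and their starting points, and `Cᵀ C` is the diagonal matrix of degrees. -/
theorem det_hashimotoMatrix :
    G.hashimotoMatrix.det =
      (-1) ^ (Fintype.card G.Dart / 2) * ∏ v, (1 - (G.degree v : ℂ)) := by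
  set C : Matrix G.Dart V ℂ := Matrix.of fun e v => if e.fst = v then 1 else 0 with hC
  have hT : G.hashimotoMatrix =
      (-(1 - C * C.transpose)).submatrix
        (Dart.symm_involutive.toPerm (Dart.symm : G.Dart → G.Dart)) id := by
    ext e f
    simp only [hashimotoMatrix, NonBacktrackingStep, Matrix.of_apply, Matrix.submatrix_apply,
      Function.Involutive.coe_toPerm, id, Matrix.neg_apply, Matrix.sub_apply, Matrix.mul_apply,
      Matrix.transpose_apply, hC, Matrix.one_apply]
    by_cases hf : e.symm = f
    · subst hf
      simp
    · simp [hf, Ne.symm hf, eq_comm]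
  have hD : C.transpose * C = Matrix.diagonal fun v => (G.degree v : ℂ) := by
    ext v w
    simp only [Matrix.mul_apply, Matrix.transpose_apply, hC, Matrix.of_apply, Matrix.diagonal_apply]
    split_ifs with hvw
    · subst hvw
      simp [← G.dart_fst_fiber_card_eq_degree v, ← ite_and]
    · refine Finset.sum_eq_zero fun e _ => ?_
      by_cases he : e.fst = v
      · simp [he, hvw]
      · simp [he]
  have heven : Even (Fintype.card G.Dart) := by
    rw [G.dart_card_eq_twice_card_edges]; exact even_two_mul _
  rw [hT, Matrix.det_permute, sign_dart_symm, Matrix.det_neg, heven.neg_one_pow, one_mul,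
    Matrix.det_one_sub_mul_comm, hD, ← Matrix.diagonal_one, Matrix.diagonal_sub,
    Matrix.det_diagonal]
  simp

end SimpleGraph

/-! ### Triangles and joins -/

namespace SimpleGraph

section Triangles

variable {V : Type*} (G : SimpleGraph V) [Fintype V] [DecidableRel G.Adj]

/-- The number of ordered triangles of `G`, that is, of closed walks of length 3. -/
def orderedTriangleCount : ℕ :=
  ∑ u, ∑ v, ∑ w, if G.Adj u v ∧ G.Adj v w ∧ G.Adj w u then 1 else 0

/-- In length 3 the absence of loops already rules out backtracking. -/
theorem ncard_closedGeodesic_three :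
    {γ | G.IsClosedGeodesic γ ∧ γ.length = 3}.ncard = G.orderedTriangleCount := by
  classical
  have hcount : G.orderedTriangleCount =
      {t : V × V × V | G.Adj t.1 t.2.1 ∧ G.Adj t.2.1 t.2.2 ∧ G.Adj t.2.2 t.1}.ncard := by
    rw [← Finset.coe_filter_univ, Set.ncard_coe_finset, Finset.card_filter, orderedTriangleCount]
    simp only [Fintype.sum_prod_type]
  rw [hcount]
  symm
  refine Set.ncard_congr (fun t ht => [⟨(t.1, t.2.1), ht.1⟩, ⟨(t.2.1, t.2.2), ht.2.1⟩,
    ⟨(t.2.2, t.1), ht.2.2⟩]) ?_ ?_ ?_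
  · rintro ⟨u, v, w⟩ ⟨h1, h2, h3⟩
    simp [IsClosedGeodesic, NonBacktrackingStep, Dart.ext_iff, h1.ne,
      h2.ne, h3.ne]
  · rintro ⟨u, v, w⟩ ⟨u', v', w'⟩ h h' heq
    simp [Dart.ext_iff] at heq
    simp [heq]
  · rintro γ ⟨⟨-, hγ⟩, hlen⟩
    match γ with
    | [e, f, g] =>
      simp only [Cycle.chain_coe_cons, List.cons_append, List.nil_append,
        List.isChain_cons_cons, NonBacktrackingStep] at hγ
      obtain ⟨⟨h1, -⟩, ⟨h2, -⟩, ⟨h3, -⟩, -⟩ := hγ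
      refine ⟨(e.fst, f.fst, g.fst), ⟨h1 ▸ e.adj, h2 ▸ f.adj, h3 ▸ g.adj⟩, ?_⟩
      simp [Dart.ext_iff, Prod.ext_iff, h1, h2, h3]

end Triangles

section Join

variable {V W : Type*} (G : SimpleGraph V) (H : SimpleGraph W)

@[simp]
theorem graphJoin_adj_inl_inl (u v : V) : (G.graphJoin H).Adj (.inl u) (.inl v) ↔ G.Adj u v := by
  simp [graphJoin]

@[simp]
theorem graphJoin_adj_inr_inr (u v : W) : (G.graphJoin H).Adj (.inr u) (.inr v) ↔ H.Adj u v := by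
  simp [graphJoin]

@[simp]
theorem graphJoin_adj_inl_inr (u : V) (v : W) : (G.graphJoin H).Adj (.inl u) (.inr v) := by
  simp [graphJoin]

@[simp]
theorem graphJoin_adj_inr_inl (u : W) (v : V) : (G.graphJoin H).Adj (.inr u) (.inl v) := by
  simp [graphJoin]

variable [Fintype V] [Fintype W] [DecidableRel (G.graphJoin H).Adj]

theorem degree_eq_sum_ite [DecidableRel G.Adj] (v : V) :
    G.degree v = ∑ u, if G.Adj v u then 1 else 0 := by
  rw [← card_neighborFinset_eq_degree, neighborFinset_eq_filter, Finset.card_filter]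

theorem degree_graphJoin_inl [DecidableRel G.Adj] (v : V) :
    (G.graphJoin H).degree (.inl v) = G.degree v + Fintype.card W := by
  rw [degree_eq_sum_ite, degree_eq_sum_ite, Fintype.sum_sum_type]
  simp

theorem degree_graphJoin_inr [DecidableRel H.Adj] (w : W) :
    (G.graphJoin H).degree (.inr w) = H.degree w + Fintype.card V := by
  rw [degree_eq_sum_ite, degree_eq_sum_ite, Fintype.sum_sum_type]
  simp [add_comm]

variable [DecidableRel G.Adj] [DecidableRel H.Adj]

theorem card_dart_graphJoin :
    Fintype.card (G.graphJoin H).Dart = ∑ v, G.degree v + ∑ w, H.degree w +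
      2 * (Fintype.card V * Fintype.card W) := by
  rw [dart_card_eq_sum_degrees, Fintype.sum_sum_type]
  simp only [degree_graphJoin_inl, degree_graphJoin_inr, Finset.sum_add_distrib, Finset.sum_const,
    Finset.card_univ, smul_eq_mul]
  ring

/-- A triangle of the join lies in `G`, lies in `H`, or consists of an edge of one of them and a
vertex of the other; the factors 3 count the positions of that vertex, as the sums of degrees count
ordered edges. -/
theorem orderedTriangleCount_graphJoin :
    (G.graphJoin H).orderedTriangleCount = G.orderedTriangleCount + H.orderedTriangleCount +
      3 * (Fintype.card W * ∑ v, G.degree v) + 3 * (Fintype.card V * ∑ w, H.degree w) := by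
  have hG : ∑ v, ∑ u, (if G.Adj u v then 1 else 0) = ∑ u, ∑ v, if G.Adj u v then 1 else 0 :=
    Finset.sum_comm
  have hH : ∑ v, ∑ u, (if H.Adj u v then 1 else 0) = ∑ u, ∑ v, if H.Adj u v then 1 else 0 :=
    Finset.sum_comm
  simp only [orderedTriangleCount, Fintype.sum_sum_type, graphJoin_adj_inl_inl,
    graphJoin_adj_inr_inr, graphJoin_adj_inl_inr, graphJoin_adj_inr_inl, true_and, and_true,
    Finset.sum_add_distrib, degree_eq_sum_ite, Finset.sum_const, Finset.card_univ, smul_eq_mul,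
    ← Finset.mul_sum, hG, hH]
  ring

theorem det_hashimotoMatrix_graphJoin [DecidableEq V] [DecidableEq W] :
    (G.graphJoin H).hashimotoMatrix.det =
      (-1) ^ (Fintype.card (G.graphJoin H).Dart / 2) *
        ((∏ v, (1 - (G.degree v + Fintype.card W : ℂ))) *
          ∏ w, (1 - (H.degree w + Fintype.card V : ℂ))) := by
  rw [det_hashimotoMatrix, Fintype.prod_sum_type]
  simp only [degree_graphJoin_inl, degree_graphJoin_inr, Nat.cast_add]

end Join

end SimpleGraph

/-! ### Invariants determined by the zeta functions of joins -/

namespace SimpleGraph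

section Invariants

variable {V V' W : Type*} [Fintype V] [Fintype V'] [Fintype W] {G : SimpleGraph V}
  {G' : SimpleGraph V'} {H : SimpleGraph W} [DecidableRel G.Adj] [DecidableRel G'.Adj]
  [DecidableRel H.Adj]

/-- If every vertex of `G ∨ H` has degree at least 2, then its Hashimoto matrix is invertible, so
its size is the number of non-zero eigenvalues, which the zeta function determines. -/
theorem card_dart_graphJoin_le (hV : 2 ≤ Fintype.card V) (hW : 2 ≤ Fintype.card W)
    (h : (G.graphJoin H).iharaZeta = (G'.graphJoin H).iharaZeta) :
    ∑ v, G.degree v + 2 * (Fintype.card V * Fintype.card W) ≤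
      ∑ v, G'.degree v + 2 * (Fintype.card V' * Fintype.card W) := by
  classical
  have hne : ∀ d k : ℕ, 2 ≤ k → (1 - (d + k : ℂ)) ≠ 0 := fun d k hk h0 => by
    have h1 : ((d + k : ℕ) : ℂ) = (1 : ℕ) := by
      push_cast; linear_combination -h0
    have := Nat.cast_injective h1
    omega
  have hle := Matrix.card_le_of_trace_pow_eq (trace_hashimotoMatrix_pow_eq_of_iharaZeta_eq h) (by
    rw [det_hashimotoMatrix_graphJoin]
    exact mul_ne_zero (pow_ne_zero _ (by norm_num)) (mul_ne_zero
      (Finset.prod_ne_zero_iff.mpr fun v _ => hne _ _ hW)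
      (Finset.prod_ne_zero_iff.mpr fun w _ => hne _ _ hV)))
  rw [card_dart_graphJoin, card_dart_graphJoin] at hle
  omega

theorem orderedTriangleCount_graphJoin_eq
    (h : (G.graphJoin H).iharaZeta = (G'.graphJoin H).iharaZeta) :
    G.orderedTriangleCount + 3 * (Fintype.card W * ∑ v, G.degree v) +
        3 * (Fintype.card V * ∑ w, H.degree w) =
      G'.orderedTriangleCount + 3 * (Fintype.card W * ∑ v, G'.degree v) +
        3 * (Fintype.card V' * ∑ w, H.degree w) := by
  classical
  have h3 := ncard_closedGeodesic_eq_of_iharaZeta_eq h (by norm_num : 0 < 3)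
  rw [ncard_closedGeodesic_three, ncard_closedGeodesic_three, orderedTriangleCount_graphJoin,
    orderedTriangleCount_graphJoin] at h3
  omega

theorem degree_eq_zero_of_card_le_one (hV : Fintype.card V ≤ 1) (v : V) : G.degree v = 0 := by
  have := G.degree_lt_card_verts v
  omega

theorem sum_degree_eq_zero_of_card_le_one (hV : Fintype.card V ≤ 1) : ∑ v, G.degree v = 0 :=
  Finset.sum_eq_zero fun v _ => degree_eq_zero_of_card_le_one hV v

/-- A graph of order 1 and a graph of order at least 2 are told apart by a join with a graph of
order at least 2, by the number of oriented edges. -/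
theorem card_le_one_of_iharaZeta_graphJoin_eq (hV : Fintype.card V ≤ 1)
    (hW : 2 ≤ Fintype.card W)
    (h : (G.graphJoin H).iharaZeta = (G'.graphJoin H).iharaZeta) :
    Fintype.card V' ≤ 1 := by
  by_contra! hV'
  have hle := card_dart_graphJoin_le hV' hW h.symm
  rw [sum_degree_eq_zero_of_card_le_one hV] at hle
  have h1 := Nat.mul_le_mul_right (Fintype.card W) hV
  have h2 := Nat.mul_le_mul_right (Fintype.card W) hV'
  omega

end Invariants

theorem exists_two_le_or_zero_one {r : ℕ} {p : Fin r → ℕ} (hp : Function.Injective p) (hr : 3 ≤ r) :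
    (∃ i j, p i ≠ p j ∧ 2 ≤ p i ∧ 2 ≤ p j) ∨ ∃ i j k, p i = 0 ∧ p j = 1 ∧ 2 ≤ p k := by
  let a : Fin r := ⟨0, by omega⟩
  let b : Fin r := ⟨1, by omega⟩
  let c : Fin r := ⟨2, by omega⟩
  have hab : p a ≠ p b := hp.ne (by simp [a, b])
  have hac : p a ≠ p c := hp.ne (by simp [a, c])
  have hbc : p b ≠ p c := hp.ne (by simp [b, c])
  have hsmall : ∀ x y z, p x ≠ p y → p x < 2 → p y < 2 → 2 ≤ p z →
      ∃ i j k, p i = 0 ∧ p j = 1 ∧ 2 ≤ p k := fun x y z hxy hx hy hz => by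
    rcases (by omega : p x = 0 ∧ p y = 1 ∨ p y = 0 ∧ p x = 1) with ⟨h0, h1⟩ | ⟨h0, h1⟩
    exacts [⟨x, y, z, h0, h1, hz⟩, ⟨y, x, z, h0, h1, hz⟩]
  rcases Nat.lt_or_ge (p a) 2 with ha | ha <;> rcases Nat.lt_or_ge (p b) 2 with hb | hb <;>
    rcases Nat.lt_or_ge (p c) 2 with hc | hc
  · omega
  · exact Or.inr (hsmall a b c hab ha hb hc)
  · exact Or.inr (hsmall a c b hac ha hc hb)
  · exact Or.inl ⟨b, c, hbc, hb, hc⟩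
  · exact Or.inr (hsmall b c a hbc hb hc ha)
  · exact Or.inl ⟨a, c, hac, ha, hc⟩
  · exact Or.inl ⟨a, b, hab, ha, hb⟩
  · exact Or.inl ⟨a, b, hab, ha, hb⟩

variable {V V' : Type*} [Fintype V] [Fintype V'] [Nonempty V] [Nonempty V'] {G : SimpleGraph V}
  {G' : SimpleGraph V'} {r : ℕ} {W : Fin r → Type*} [∀ j, Fintype (W j)]
  {H : ∀ j, SimpleGraph (W j)}

/-- The zeta functions of the joins with three graphs of distinct orders determine the order and
the size. -/
theorem card_eq_and_sum_degree_eq [DecidableRel G.Adj] [DecidableRel G'.Adj] (hr : 3 ≤ r)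
    (hW : Function.Injective fun j => Fintype.card (W j))
    (h : ∀ j, (G.graphJoin (H j)).iharaZeta = (G'.graphJoin (H j)).iharaZeta) :
    Fintype.card V = Fintype.card V' ∧ ∑ v, G.degree v = ∑ v, G'.degree v := by
  classical
  have hcases := exists_two_le_or_zero_one hW hr
  obtain ⟨k, hk⟩ : ∃ k, 2 ≤ Fintype.card (W k) := by
    rcases hcases with ⟨i, -, -, hi, -⟩ | ⟨-, -, k, -, -, hk⟩
    exacts [⟨i, hi⟩, ⟨k, hk⟩]
  have hV0 : 0 < Fintype.card V := Fintype.card_pos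
  have hV0' : 0 < Fintype.card V' := Fintype.card_pos
  by_cases hV : Fintype.card V ≤ 1
  · have hV' := card_le_one_of_iharaZeta_graphJoin_eq hV hk (h k)
    rw [sum_degree_eq_zero_of_card_le_one hV, sum_degree_eq_zero_of_card_le_one hV']
    omega
  have hV' : ¬Fintype.card V' ≤ 1 := fun hV' =>
    hV (card_le_one_of_iharaZeta_graphJoin_eq hV' hk (h k).symm)
  have hdart : ∀ j, 2 ≤ Fintype.card (W j) →
      ∑ v, G.degree v + 2 * (Fintype.card V * Fintype.card (W j)) =
        ∑ v, G'.degree v + 2 * (Fintype.card V' * Fintype.card (W j)) := fun j hj =>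
    le_antisymm (card_dart_graphJoin_le (by omega) hj (h j))
      (card_dart_graphJoin_le (by omega) hj (h j).symm)
  -- The joins with two graphs of different orders at least 2 give independent linear equations.
  -- Otherwise the triangle counts of the joins with the graphs of orders 0 and 1, neither of which
  -- has an edge, give the size.
  rcases hcases with ⟨i, j, hij, hi, hj⟩ | ⟨i, j, k, hi, hj, hk⟩
  · have hi' := hdart i hi
    have hj' := hdart j hj
    have hmul : ((Fintype.card V : ℤ) - Fintype.card V') *
        (Fintype.card (W i) - Fintype.card (W j)) = 0 := by
      zify at hi' hj'
      linarith
    have hcard : Fintype.card V = Fintype.card V' := by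
      rcases mul_eq_zero.mp hmul with h0 | h0 <;> omega
    rw [hcard] at hi'
    exact ⟨hcard, by omega⟩
  · have hi' := orderedTriangleCount_graphJoin_eq (h i)
    have hj' := orderedTriangleCount_graphJoin_eq (h j)
    rw [sum_degree_eq_zero_of_card_le_one (G := H i) (by omega), hi] at hi'
    rw [sum_degree_eq_zero_of_card_le_one (G := H j) (by omega), hj] at hj'
    have hsum : ∑ v, G.degree v = ∑ v, G'.degree v := by omega
    have hk' := hdart k hk
    rw [hsum, add_right_inj, Nat.mul_right_inj two_ne_zero] at hk'
    exact ⟨Nat.eq_of_mul_eq_mul_right (by omega) hk', hsum⟩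

open Polynomial in
/-- A finite family of natural numbers is determined, as a multiset, by the values of
`∏ (1 - (d + x))` at as many points `x` as it has members. -/
theorem map_eq_of_prod_one_sub_add_eq {V V' : Type*} [Fintype V] [Fintype V'] {r : ℕ}
    {d : V → ℕ} {d' : V' → ℕ}
    (hcard : Fintype.card V = Fintype.card V') (hr : Fintype.card V ≤ r) {p : Fin r → ℕ}
    (hp : Function.Injective p)
    (h : ∀ j, ∏ v, (1 - (d v + p j : ℂ)) = ∏ v, (1 - (d' v + p j : ℂ))) :
    Finset.univ.val.map d = Finset.univ.val.map d' := by
  set F : ℂ[X] := ∏ v, (X - C ((d v : ℂ) - 1)) with hF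
  set F' : ℂ[X] := ∏ v, (X - C ((d' v : ℂ) - 1)) with hF'
  have hdeg : F.degree = Fintype.card V := by
    rw [hF, degree_prod]; simp only [degree_X_sub_C, Finset.sum_const]; simp
  have hdeg' : F'.degree = Fintype.card V := by
    rw [hF', degree_prod, hcard]; simp only [degree_X_sub_C, Finset.sum_const]; simp
  have hmon : F.Monic := monic_prod_of_monic _ _ fun v _ => monic_X_sub_C _
  have hmon' : F'.Monic := monic_prod_of_monic _ _ fun v _ => monic_X_sub_C _
  have hFF' : F = F' := by
    refine eq_of_degree_sub_lt_of_eval_index_eq (s := (Finset.univ : Finset (Fin r)))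
      (v := fun j => -(p j : ℂ)) (fun i _ j _ hij => hp (by simpa using hij)) ?_ fun j _ => ?_
    · refine (degree_sub_lt_left (hdeg.trans hdeg'.symm) hmon.ne_zero ?_).trans_le ?_
      · rw [hmon.leadingCoeff, hmon'.leadingCoeff]
      · rw [hdeg]
        simpa using hr
    -- The values of the monic polynomials at `-x` are the products at `x`.
    · have e : ∀ x : ℂ, -(p j : ℂ) - (x - 1) = 1 - (x + p j) := fun x => by ring
      simp only [hF, hF', eval_prod, eval_sub, eval_X, eval_C, e, h j]
  have hroots := congrArg roots hFF'
  rw [hF, hF', roots_prod _ _ hmon.ne_zero, roots_prod _ _ hmon'.ne_zero] at hroots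
  simp only [roots_X_sub_C, Multiset.bind_singleton] at hroots
  refine Multiset.map_injective (f := fun m : ℕ => (m : ℂ) - 1)
    (fun a b hab => by simpa using hab) ?_
  simpa only [Multiset.map_map, Function.comp_def] using hroots

/-- The equal determinants of the Hashimoto matrices of the joins give the values of the polynomial
`∏ (1 - (d_v + x))` at the orders of the graphs `H j`. -/
theorem degreeMultiset_eq_of_iharaZeta_graphJoin_eq (hr : 3 ≤ r) (hVr : Fintype.card V ≤ r)
    (hW : Function.Injective fun j => Fintype.card (W j))
    (h : ∀ j, (G.graphJoin (H j)).iharaZeta = (G'.graphJoin (H j)).iharaZeta) :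
    G.degreeMultiset = G'.degreeMultiset := by
  classical
  obtain ⟨hcard, hsum⟩ := card_eq_and_sum_degree_eq hr hW h
  -- In order 1 the factor of the determinant that comes from `H j` vanishes if `H j` has an
  -- isolated vertex, but then the degree sequences are those of a single vertex.
  rcases le_or_gt (Fintype.card V) 1 with hV | hV
  · rw [degreeMultiset, degreeMultiset,
      Multiset.map_congr rfl fun v _ => degree_eq_zero_of_card_le_one hV v,
      Multiset.map_congr rfl fun v _ => degree_eq_zero_of_card_le_one (hcard ▸ hV) v]
    simp [hcard]
  · refine map_eq_of_prod_one_sub_add_eq hcard hVr hW fun j => ?_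
    have hdart : Fintype.card (G.graphJoin (H j)).Dart =
        Fintype.card (G'.graphJoin (H j)).Dart := by
      rw [card_dart_graphJoin, card_dart_graphJoin, hsum, hcard]
    have hdet := Matrix.det_eq_of_trace_pow_eq
      (trace_hashimotoMatrix_pow_eq_of_iharaZeta_eq (h j)) hdart
    rw [det_hashimotoMatrix_graphJoin, det_hashimotoMatrix_graphJoin, hdart, ← hcard] at hdet
    refine mul_right_cancel₀ ?_ (mul_left_cancel₀ (pow_ne_zero _ (by norm_num)) hdet)
    refine Finset.prod_ne_zero_iff.mpr fun w _ h0 => ?_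
    have h1 : (((H j).degree w + Fintype.card V : ℕ) : ℂ) = (1 : ℕ) := by
      push_cast; linear_combination -h0
    have := Nat.cast_injective h1
    omega

end SimpleGraph

theorem mainTheorem2 (n : ℕ) (hn : 1 ≤ n) :
    ∃ r : ℕ, r ≤ max n 3 ∧
      ∀ (V : Type*) [Fintype V] (G : SimpleGraph V), Fintype.card V = n →
        (∀ (W : Fin r → Type*) [∀ j, Fintype (W j)] (H : ∀ j, SimpleGraph (W j)),
          Function.Injective (fun j => Fintype.card (W j)) →
          ∀ (V' : Type*) [Fintype V'] [Nonempty V'] (G' : SimpleGraph V'),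
            (∀ j, (G.graphJoin (H j)).iharaZeta = (G'.graphJoin (H j)).iharaZeta) →
            G.degreeMultiset = G'.degreeMultiset) ∧
        (∀ (V' : Type*) [Fintype V'] [Nonempty V'] (G' : SimpleGraph V'),
          (∀ j : ℕ, 1 ≤ j → j ≤ r →
            (G.graphJoin (SimpleGraph.completeGraph (Fin j))).iharaZeta =
              (G'.graphJoin (SimpleGraph.completeGraph (Fin j))).iharaZeta) →
          G.degreeMultiset = G'.degreeMultiset) := by
  refine ⟨max n 3, le_rfl, fun V _ G hV => ?_⟩
  have : Nonempty V := Fintype.card_pos_iff.mp (by omega)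
  have hVr : Fintype.card V ≤ max n 3 := hV ▸ le_max_left _ _
  refine ⟨fun W _ H hW V' _ _ G' h => ?_, fun V' _ _ G' h => ?_⟩
  · exact SimpleGraph.degreeMultiset_eq_of_iharaZeta_graphJoin_eq (le_max_right _ _) hVr hW h
  · refine SimpleGraph.degreeMultiset_eq_of_iharaZeta_graphJoin_eq
      (W := fun j : Fin (max n 3) => Fin (j + 1)) (H := fun j => SimpleGraph.completeGraph _)
      (le_max_right _ _) hVr (fun i j hij => ?_) fun j => h (j + 1) (by omega) (by omega)
    simpa [Fin.ext_iff] using hij
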